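/- Let $C=\mathbb{C}[x,y]$ and let $\mathbb{Z}^2$ act on $C$ by translation, so that $(a,b)\in\mathbb{Z}^2$ acts as the $\mathbb{C}$-algebra automorphism $x\mapsto x+a$, $y\mapsto y+b$. Let $B=C\#\mathbb{Z}^2$ be the skew group ring: the free left $C$-module with basis $\mathbb{Z}^2$ and multiplication $(rg)(sh)=(r\,s^{g})(gh)$ for $r,s\in C$ and $g,h\in\mathbb{Z}^2$, where $s^{g}$ is the image of $s$ under $g$. For a right ideal $J$ of $B$ write $\mathbb{I}_B(J)=\{b\in B: bJ\subseteq J\}$, and for a left ideal $J$ of $B$ write $\mathbb{I}^{\ell}_B(J)=\{b\in B: Jb\subseteq J\}$. Let $I$ be a non-zero, non-maximal prime ideal of $C$ that is not the ideal of a line of rational slope (slope $\infty$ included); that is, $I\neq(mx-ny-p)$ for all $(m,n)\in\mathbb{Z}^2\setminus\{(0,0)\}$ and $p\in\mathbb{C}$. Let $V(I)\subseteq\mathbb{C}^2$ be its zero set. Then: 1. $\mathbb{I}_B(IB)$ is left noetherian if and only if $V(I)\cap(b+\mathbb{Z}^2)$ is finite for every $b\in\mathbb{C}^2$. 2. $\mathbb{I}_B(IB)$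 is right noetherian if and only if $V(I)\cap(b+\mathbb{Z}^2)$ is finite for every $b\in\mathbb{C}^2$. (In particular, $\mathbb{I}_B(IB)$ is left and right noetherian if and only if $V(I)\cap(b+\mathbb{Z}^2)$ is finite for every $b\in\mathbb{C}^2$.) 3. $I=(f)$ for some irreducible $f\in C$, and there is a ring isomorphism $\theta:\mathbb{I}_B(IB)\to\mathbb{I}^{\ell}_B(BI)$ given by conjugation by $f$, that is, with $f\,\theta(a)=a f$ in $B$ for all $a\in\mathbb{I}_B(IB)$. -/

import Mathlib

open scoped MulOpposite

noncomputable section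

namespace Idealiser

/-! ### Idealisers -/

section General

variable {B : Type*} [Ring B]

/-- The right ideal of `B` generated by a subset `S`. Right ideals of `B` are
`Bᵐᵒᵖ`-submodules of `B`. -/
def rightIdealSpan (S : Set B) : Submodule Bᵐᵒᵖ B := Submodule.span Bᵐᵒᵖ S

/-- The left ideal of `B` generated by a subset `S`. -/
def leftIdealSpan (S : Set B) : Submodule B B := Submodule.span B S

/-- The idealiser `{b ∈ B | b J ⊆ J}` of a right ideal `J` of `B`. -/
def idealiser (J : Submodule Bᵐᵒᵖ B) : Subring B where
  carrier := {b | ∀ x ∈ J, b * x ∈ J}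
  mul_mem' {a b} ha hb x hx := by
    rw [mul_assoc]; exact ha _ (hb x hx)
  one_mem' x hx := by rwa [one_mul]
  add_mem' {a b} ha hb x hx := by
    rw [add_mul]; exact J.add_mem (ha x hx) (hb x hx)
  zero_mem' x hx := by rw [zero_mul]; exact J.zero_mem
  neg_mem' {a} ha x hx := by
    rw [neg_mul]; exact J.neg_mem (ha x hx)

/-- The (left) idealiser `{b ∈ B | J b ⊆ J}` of a left ideal `J` of `B`. -/
def leftIdealiser (J : Submodule B B) : Subring B where
  carrier := {b | ∀ x ∈ J, x * b ∈ J}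
  mul_mem' {a b} ha hb x hx := by
    rw [← mul_assoc]; exact hb _ (ha x hx)
  one_mem' x hx := by rwa [mul_one]
  add_mem' {a b} ha hb x hx := by
    rw [mul_add]; exact J.add_mem (ha x hx) (hb x hx)
  zero_mem' x hx := by rw [mul_zero]; exact J.zero_mem
  neg_mem' {a} ha x hx := by
    rw [mul_neg]; exact J.neg_mem (ha x hx)

/-- Every left ideal of `R` is finitely generated. -/
def IsLeftNoetherian (R : Type*) [Ring R] : Prop := IsNoetherian R R

/-- Every right ideal of `R` is finitely generated. -/
def IsRightNoetherian (R : Type*) [Ring R] : Prop := IsNoetherian Rᵐᵒᵖ R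

end General

/-! ### The translation action of `ℤ²` on `ℂ[x, y]` -/

/-- The polynomial ring `ℂ[x, y]`, with `x = X 0` and `y = X 1`. -/
abbrev Poly : Type := MvPolynomial (Fin 2) ℂ

/-- The group `ℤ²`, written multiplicatively. -/
abbrev Grp : Type := Multiplicative (Fin 2 → ℤ)

/-- The `ℂ`-algebra endomorphism `x ↦ x + a₀`, `y ↦ y + a₁` of `ℂ[x, y]`. -/
def translate (a : Fin 2 → ℤ) : Poly →ₐ[ℂ] Poly :=
  MvPolynomial.aeval fun i => MvPolynomial.X i + MvPolynomial.C (a i : ℂ)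

lemma translate_X (a : Fin 2 → ℤ) (i : Fin 2) :
    translate a (MvPolynomial.X i) = MvPolynomial.X i + MvPolynomial.C (a i : ℂ) := by
  simp [translate]

lemma translate_zero : translate 0 = AlgHom.id ℂ Poly := by
  apply MvPolynomial.algHom_ext
  intro i
  simp [translate_X]

lemma translate_add (a b : Fin 2 → ℤ) :
    translate (a + b) = (translate a).comp (translate b) := by
  apply MvPolynomial.algHom_ext
  intro i
  have h : translate a (MvPolynomial.C (b i : ℂ)) = MvPolynomial.C (b i : ℂ) :=
    (translate a).commutes _
  rw [AlgHom.comp_apply, translate_X, translate_X, map_add, translate_X, h]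
  simp only [Pi.add_apply, Int.cast_add, map_add]
  ring

/-- `ℤ²` acts on `ℂ[x, y]` by translation: `(1, 0)` acts as `σ : x ↦ x + 1, y ↦ y` and
`(0, 1)` acts as `τ : x ↦ x, y ↦ y + 1`. -/
instance translationAction : MulSemiringAction Grp Poly where
  smul g p := translate g.toAdd p
  one_smul p := by
    change translate 0 p = p
    rw [translate_zero]; rfl
  mul_smul g h p := by
    change translate (g.toAdd + h.toAdd) p = translate g.toAdd (translate h.toAdd p)
    rw [translate_add]; rfl
  smul_zero g := map_zero (translate g.toAdd)
  smul_add g := map_add (translate g.toAdd)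
  smul_one g := map_one (translate g.toAdd)
  smul_mul g := map_mul (translate g.toAdd)

/-- The skew group ring `B = ℂ[x, y] # ℤ²`: finite formal sums `∑ c_g g` with
multiplication `(c g) (d h) = (c (g • d)) (g h)`. -/
abbrev Skew : Type := SkewMonoidAlgebra Poly Grp

/-- The inclusion `ℂ[x, y] → B`, sending `c` to `c · 1`. -/
def incl : Poly →+* Skew := SkewMonoidAlgebra.singleOneRingHom

lemma incl_apply (c : Poly) : incl c = SkewMonoidAlgebra.single 1 c := rfl

/-- The skew multiplication rule `(c g) (d h) = (c (g • d)) (g h)`. -/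
lemma single_mul_single' (g h : Grp) (c d : Poly) :
    (SkewMonoidAlgebra.single g c * SkewMonoidAlgebra.single h d : Skew) =
      SkewMonoidAlgebra.single (g * h) (c * translate g.toAdd d) :=
  SkewMonoidAlgebra.single_mul_single

/-- The right ideal `I B` of `B`. -/
def rightExt (I : Ideal Poly) : Submodule Skewᵐᵒᵖ Skew := rightIdealSpan (incl '' (I : Set Poly))

/-- The left ideal `B I` of `B`. -/
def leftExt (I : Ideal Poly) : Submodule Skew Skew := leftIdealSpan (incl '' (I : Set Poly))

/-- `I` is the ideal of a line of rational slope, slope `∞` included: `I = (m x - n y - p)`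
with `m, n ∈ ℤ` not both zero and `p ∈ ℂ`. -/
def IsRationalLine (I : Ideal Poly) : Prop :=
  ∃ (m n : ℤ) (p : ℂ), (m ≠ 0 ∨ n ≠ 0) ∧
    I = Ideal.span {MvPolynomial.C (m : ℂ) * MvPolynomial.X 0
      - MvPolynomial.C (n : ℂ) * MvPolynomial.X 1 - MvPolynomial.C p}

/-- The coset `b + ℤ²` in `ℂ²`. -/
def latticeCoset (b : Fin 2 → ℂ) : Set (Fin 2 → ℂ) :=
  Set.range fun a : Fin 2 → ℤ => fun i => b i + (a i : ℂ)

/-- `V(I) ∩ (b + ℤ²)` is finite for every `b ∈ ℂ²`. -/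
def FiniteOnCosets (I : Ideal Poly) : Prop :=
  ∀ b : Fin 2 → ℂ, (MvPolynomial.zeroLocus ℂ I ∩ latticeCoset b).Finite

end Idealiser

end

noncomputable section

namespace Idealiser

/-! ### Hilbert's basis theorem for skew Laurent extensions -/

section SkewLaurent

variable {A S : Type*} [Ring A] [Ring S] (φ : A →+* S) (t : Sˣ)

/-! Since `C = ℂ[x, y]` has dimension two, `I = (f)` with `f` irreducible. An irreducible `f`
dividing a non-trivial translate of itself cuts out a line of rational slope (`not_dvd_translate`),
so comparing coefficients in `a f ∈ f B` shows that the idealiser is `R = C + f B`.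

If `R` is left noetherian, let `m_b` be the maximal ideal of a point `b` and consider the left
`R`-module `(f B ∩ B m_b) / f B m_b`. Left multiplication by `f B` kills it, so it is finitely
generated over `C`, and representatives `f y` can be chosen with all the `y` supported in one finite
set. But `f g` has non-zero class whenever `f (b - g) = 0`, so there are only finitely many such
`g`.

Conversely let `K` be a left ideal of `R`. As `B` is noetherian (two skew Laurent extensions of
`C`), a finite `s ⊆ K` generates `B K`, and `f B ⊆ R` gives `f B K ⊆ R s`. What remains is the image
of `K` in `C / (f)` and the set of `x` with `f x ∈ K`, whose classes in `B / B K` are `f`-torsion.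
This torsion is finitely generated over `C` (`torsionBy_fg`): an associated prime `P` containing `f`
is either `(f)` or the ideal of a point, its translates are incomparable, and the coset condition
leaves finitely many of them containing `f`.

For the right-handed statement, conjugation by `f` carries `R` to the left idealiser of `B f`, and
the anti-automorphism of `B` inverting `ℤ²` carries that back to `R`; hence `R ≃ Rᵐᵒᵖ`. -/

/-- If `S` is generated as an `A`-module by the powers of a unit normalising the image of a
left noetherian ring `A`, then `S` is left noetherian. -/
theorem isNoetherianRing_of_skewLaurent [IsNoetherianRing A]
    (h₁ : ∀ a, ∃ a', φ a * t = t * φ a') (h₂ : ∀ a, ∃ a', t * φ a = φ a' * t)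
    (hspan : AddSubmonoid.closure {x : S | ∃ (i : ℤ) (a : A), x = φ a * (t ^ i : Sˣ)} = ⊤) :
    IsNoetherianRing S := by
  let _ : Module A S := Module.compHom S φ
  have smul_def : ∀ (a : A) (s : S), a • s = φ a * s := fun _ _ => rfl
  have h₁' : ∀ (n : ℕ) (a : A), ∃ a', φ a * (t : S) ^ n = (t : S) ^ n * φ a' := by
    intro n
    induction n with
    | zero => exact fun a => ⟨a, by simp⟩
    | succ n ih =>
      intro a
      obtain ⟨b, hb⟩ := ih a
      obtain ⟨c, hc⟩ := h₁ b
      exact ⟨c, by rw [pow_succ, ← mul_assoc, hb, mul_assoc, hc, mul_assoc]⟩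
  have h₂' : ∀ (n : ℕ) (a : A), ∃ a', (t : S) ^ n * φ a = φ a' * (t : S) ^ n := by
    intro n
    induction n with
    | zero => exact fun a => ⟨a, by simp⟩
    | succ n ih =>
      intro a
      obtain ⟨b, hb⟩ := h₂ a
      obtain ⟨c, hc⟩ := ih b
      exact ⟨c, by rw [pow_succ, mul_assoc, hb, ← mul_assoc, hc, mul_assoc]⟩
  -- The elements of degree strictly below `n` in non-negative powers of `t`; in particular `F 0 =
  -- 0`.
  let F : ℕ → Submodule A S := fun n => Submodule.span A ((fun i : ℕ => (t : S) ^ i) '' Set.Iio n)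
  have F_mono : Monotone F := fun m n h =>
    Submodule.span_mono (Set.image_mono (Set.Iio_subset_Iio h))
  have F_fg : ∀ n, (F n).FG := fun n => Submodule.fg_span ((Set.finite_Iio n).image _)
  have pow_mem : ∀ n, (t : S) ^ n ∈ F (n + 1) := fun n =>
    Submodule.subset_span ⟨n, by simp, rfl⟩
  have top_mem : ∀ n a, (t : S) ^ n * φ a ∈ F (n + 1) := by
    intro n a
    obtain ⟨b, hb⟩ := h₂' n a
    rw [hb, ← smul_def]
    exact Submodule.smul_mem _ _ (pow_mem n)
  have F_succ : ∀ n s, s ∈ F (n + 1) → ∃ u ∈ F n, ∃ a, s = (t : S) ^ n * φ a + u := by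
    intro n s hs
    have hI : Set.Iio (n + 1) = insert n (Set.Iio n) := by
      ext i; simp only [Set.mem_Iio, Set.mem_insert_iff]; omega
    have : s ∈ Submodule.span A (insert ((t : S) ^ n) ((fun i : ℕ => (t : S) ^ i) '' Set.Iio n)) := by
      rwa [← Set.image_insert_eq (f := fun i : ℕ => (t : S) ^ i), ← hI]
    obtain ⟨a, u, hu, rfl⟩ := Submodule.mem_span_insert.1 this
    obtain ⟨b, hb⟩ := h₁' n a
    exact ⟨u, hu, b, by rw [smul_def, hb]⟩
  have shift : ∀ n k s, s ∈ F n → (t : S) ^ k * s ∈ F (n + k) := by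
    intro n k s hs
    induction hs using Submodule.span_induction with
    | mem x hx =>
      obtain ⟨i, hi, rfl⟩ := hx
      refine Submodule.subset_span ⟨k + i, ?_, pow_add _ _ _⟩
      simp only [Set.mem_Iio] at hi ⊢; omega
    | zero => rw [mul_zero]; exact Submodule.zero_mem _
    | add x y _ _ hx hy => rw [mul_add]; exact Submodule.add_mem _ hx hy
    | smul a x _ hx =>
      obtain ⟨b, hb⟩ := h₂' k a
      rw [smul_def, ← mul_assoc, hb, mul_assoc, ← smul_def]
      exact Submodule.smul_mem _ _ hx
  -- Negative powers are cleared by a left power of `t`, which is a unit, so generators of left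
  -- ideals may be sought among the non-negative powers.
  have exhaust : ∀ s : S, ∃ m n : ℕ, (t : S) ^ m * s ∈ F n := by
    intro s
    have hs : s ∈ AddSubmonoid.closure {x : S | ∃ (i : ℤ) (a : A), x = φ a * (t ^ i : Sˣ)} :=
      hspan ▸ AddSubmonoid.mem_top s
    induction hs using AddSubmonoid.closure_induction with
    | mem x hx =>
      obtain ⟨i, a, rfl⟩ := hx
      obtain ⟨b, hb⟩ := h₂' i.natAbs a
      obtain ⟨j, hj⟩ : ∃ j : ℕ, (i.natAbs : ℤ) + i = j := ⟨(i.natAbs + i).toNat, by omega⟩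
      refine ⟨i.natAbs, j + 1, ?_⟩
      have : (t : S) ^ i.natAbs * ((t ^ i : Sˣ) : S) = (t : S) ^ j := by
        rw [← Units.val_pow_eq_pow_val, ← Units.val_pow_eq_pow_val, ← Units.val_mul,
          ← zpow_natCast, ← zpow_natCast, ← zpow_add, hj]
      rw [← mul_assoc, hb, mul_assoc, this, ← smul_def]
      exact Submodule.smul_mem _ _ (pow_mem j)
    | zero => exact ⟨0, 0, by rw [mul_zero]; exact Submodule.zero_mem _⟩
    | add x y _ _ hx hy =>
      obtain ⟨m, n, h⟩ := hx
      obtain ⟨m', n', h'⟩ := hy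
      refine ⟨m + m', n + m' + (n' + m), ?_⟩
      rw [mul_add]
      refine Submodule.add_mem _ (F_mono (a := n + m') (by omega) ?_)
        (F_mono (a := n' + m) (by omega) ?_)
      · rw [add_comm m, pow_add, mul_assoc]; exact shift _ _ _ h
      · rw [pow_add, mul_assoc]; exact shift _ _ _ h'
  refine (isNoetherianRing_iff_ideal_fg S).2 fun K => ?_
  -- Leading coefficients in degree `n`, written to the right of `t ^ n`: left multiplication by `t`
  -- then leaves them unchanged, so the ideals increase without any twist.
  let L : ℕ →o Ideal A :=
    { toFun := fun n =>
        { carrier := {a | ∃ u ∈ F n, (t : S) ^ n * φ a + u ∈ K}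
          add_mem' := by
            rintro a b ⟨u, hu, hK⟩ ⟨v, hv, hK'⟩
            refine ⟨u + v, Submodule.add_mem _ hu hv, ?_⟩
            have := K.add_mem hK hK'
            rwa [add_add_add_comm, ← mul_add, ← map_add] at this
          zero_mem' := ⟨0, Submodule.zero_mem _, by simp⟩
          smul_mem' := by
            rintro b a ⟨u, hu, hK⟩
            obtain ⟨c, hc⟩ := h₂' n b
            refine ⟨c • u, Submodule.smul_mem _ _ hu, ?_⟩
            have := K.mul_mem_left (φ c) hK
            rwa [mul_add, ← mul_assoc, ← hc, mul_assoc, ← map_mul] at this }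
      monotone' := monotone_nat_of_le_succ (by
        rintro n a ⟨u, hu, hK⟩
        refine ⟨t * u, by simpa using shift n 1 u hu, ?_⟩
        have := K.mul_mem_left (t : S) hK
        rwa [mul_add, ← mul_assoc, ← pow_succ'] at this) }
  obtain ⟨N, hN⟩ := monotone_stabilizes_iff_noetherian.2 (inferInstance : IsNoetherian A A) L
  let KA : Submodule A S :=
    { carrier := K
      add_mem' := K.add_mem
      zero_mem' := K.zero_mem
      smul_mem' := fun a s hs => K.mul_mem_left (φ a) hs }
  have : IsNoetherian A (F (N + 1)) := isNoetherian_of_fg_of_noetherian _ (F_fg _)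
  obtain ⟨s, hs⟩ : (KA ⊓ F (N + 1)).FG := Submodule.FG.of_le (F_fg (N + 1)) inf_le_right
  have span_le : ∀ x ∈ KA ⊓ F (N + 1), x ∈ Submodule.span S (s : Set S) := by
    intro x hx
    rw [← hs] at hx
    induction hx using Submodule.span_induction with
    | mem x hx => exact Submodule.subset_span hx
    | zero => exact Submodule.zero_mem _
    | add x y _ _ hx hy => exact Submodule.add_mem _ hx hy
    | smul a x _ hx => exact Submodule.smul_mem _ (φ a) hx
  have key : ∀ n, ∀ x ∈ K, x ∈ F n → x ∈ Submodule.span S (s : Set S) := by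
    intro n
    induction n with
    | zero => exact fun x hx hF => span_le x ⟨hx, F_mono (Nat.zero_le _) hF⟩
    | succ n ih =>
      intro x hx hF
      rcases lt_or_ge n (N + 1) with hn | hn
      · exact span_le x ⟨hx, F_mono (by omega) hF⟩
      · obtain ⟨u, hu, a, rfl⟩ := F_succ n x hF
        have ha : a ∈ L N := by rw [hN n (by omega)]; exact ⟨u, hu, hx⟩
        obtain ⟨v, hv, hK⟩ := ha
        have hv' := Submodule.add_mem _ (top_mem N a) (F_mono (Nat.le_succ N) hv)
        -- An element of `K` of degree `N` with the same leading coefficient, shifted up by `t ^ (n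
        -- - N)`, cancels the top term.
        have hmem := Submodule.smul_mem _ ((t : S) ^ (n - N)) (span_le _ ⟨hK, hv'⟩)
        have hdiff : (t : S) ^ n * φ a + u - (t : S) ^ (n - N) * ((t : S) ^ N * φ a + v)
            = u - (t : S) ^ (n - N) * v := by
          rw [mul_add, ← mul_assoc, ← pow_add, Nat.sub_add_cancel (by omega)]
          abel
        have hF' : u - (t : S) ^ (n - N) * v ∈ F n := by
          refine Submodule.sub_mem _ hu ?_
          have := shift N (n - N) v hv
          rwa [Nat.add_sub_cancel' (by omega)] at this
        have hK' := K.sub_mem hx (K.mul_mem_left ((t : S) ^ (n - N)) hK)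
        rw [hdiff] at hK'
        have := Submodule.add_mem _ (ih _ hK' hF') hmem
        rwa [← hdiff, smul_eq_mul, sub_add_cancel] at this
  refine ⟨s, le_antisymm (Submodule.span_le.2 fun x hx => ?_) fun x hx => ?_⟩
  · have : x ∈ KA ⊓ F (N + 1) := hs ▸ Submodule.subset_span hx
    exact this.1
  · obtain ⟨m, n, h⟩ := exhaust x
    have := Submodule.smul_mem _ (((t⁻¹) ^ m : Sˣ) : S) (key n _ (K.mul_mem_left _ hx) h)
    rwa [smul_eq_mul, ← mul_assoc, ← Units.val_pow_eq_pow_val, ← Units.val_mul, inv_pow,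
      inv_mul_cancel, Units.val_one, one_mul] at this

end SkewLaurent

/-! ### The skew group ring is left noetherian -/

open SkewMonoidAlgebra

/-- The subring of `B` of the elements supported on `ℤ × 0`. -/
def firstAxisSubring : Subring Skew where
  carrier := {b | ∀ g : Grp, g.toAdd 1 ≠ 0 → b.coeff g = 0}
  mul_mem' {a b} ha hb g hg := by
    rw [coeff_mul_left]
    refine Finset.sum_eq_zero fun h _ => ?_
    by_cases hh : h.toAdd 1 = 0
    · have : b.coeff (h⁻¹ * g) = 0 := hb _ (by simpa [hh] using hg)
      simp only [this, smul_zero, mul_zero]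
    · have : a.coeff h = 0 := ha h hh
      simp only [this, zero_mul]
  one_mem' g hg := by
    rw [coeff_one, Finsupp.single_apply, if_neg]
    rintro rfl; exact hg rfl
  add_mem' {a b} ha hb g hg := by rw [coeff_add, Finsupp.add_apply, ha g hg, hb g hg, add_zero]
  zero_mem' _ _ := rfl
  neg_mem' {a} ha g hg := by rw [coeff_neg, Finsupp.neg_apply, ha g hg, neg_zero]

lemma single_mem_firstAxisSubring {g : Grp} (hg : g.toAdd 1 = 0) (c : Poly) :
    (single g c : Skew) ∈ firstAxisSubring := by
  intro h hh
  rw [coeff_single, Finsupp.single_apply, if_neg]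
  rintro rfl; exact hh hg

lemma single_eq_incl_mul (g : Grp) (c : Poly) : (single g c : Skew) = incl c * single g 1 := by
  rw [incl_apply, single_mul_single', one_mul, map_one, mul_one]

/-- The embedding of the `i`-th coordinate axis of `ℤ²` into the units of `B`. -/
def axis (i : Fin 2) : Multiplicative ℤ →* Grp :=
  AddMonoidHom.toMultiplicative (AddMonoidHom.single (fun _ : Fin 2 => ℤ) i)

lemma toAdd_axis (i : Fin 2) (n : Multiplicative ℤ) :
    (axis i n).toAdd = Pi.single i n.toAdd := rfl

lemma skew_eq_sum (b : Skew) : b = ∑ g ∈ b.support, single g (b.coeff g) :=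
  (sum_single b).symm

/-- The generator of the first axis, as a unit of the subring of elements supported there. -/
def firstAxisUnit : Multiplicative ℤ →* firstAxisSubringˣ :=
  MonoidHom.toHomUnits (((SkewMonoidAlgebra.of Poly Grp).comp (axis 0)).codRestrict
    firstAxisSubring fun n => single_mem_firstAxisSubring (by simp [toAdd_axis]) 1)

lemma firstAxisUnit_coe (n : Multiplicative ℤ) :
    ((firstAxisUnit n : firstAxisSubring) : Skew) = single (axis 0 n) 1 := rfl

instance isNoetherianRing_firstAxisSubring : IsNoetherianRing firstAxisSubring := by
  refine isNoetherianRing_of_skewLaurent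
    (incl.codRestrict firstAxisSubring fun c => single_mem_firstAxisSubring rfl c)
    (firstAxisUnit (Multiplicative.ofAdd 1)) (fun a => ?_) (fun a => ?_) ?_
  · refine ⟨translate (-(axis 0 (Multiplicative.ofAdd 1)).toAdd) a, Subtype.ext ?_⟩
    change single 1 a * single (axis 0 (Multiplicative.ofAdd 1)) 1
      = single (axis 0 (Multiplicative.ofAdd 1)) 1 * single 1 _
    rw [single_mul_single', single_mul_single', ← AlgHom.comp_apply, ← translate_add]
    simp [translate_zero]
  · refine ⟨translate (axis 0 (Multiplicative.ofAdd 1)).toAdd a, Subtype.ext ?_⟩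
    change single (axis 0 (Multiplicative.ofAdd 1)) 1 * single 1 a
      = single 1 _ * single (axis 0 (Multiplicative.ofAdd 1)) 1
    rw [single_mul_single', single_mul_single']
    simp
  · refine eq_top_iff.2 fun x _ => ?_
    have hx : x = ∑ g ∈ (x : Skew).support.attach, ⟨single g.1 ((x : Skew).coeff g.1),
        single_mem_firstAxisSubring (by
          by_contra h
          exact mem_support_iff.1 g.2 (x.2 _ h)) _⟩ := by
      apply Subtype.ext
      rw [AddSubmonoidClass.coe_finsetSum]
      conv_lhs => rw [skew_eq_sum (x : Skew)]
      exact (Finset.sum_attach _ fun g => single g ((x : Skew).coeff g)).symm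
    rw [hx]
    refine sum_mem fun g _ => AddSubmonoid.subset_closure
      ⟨g.1.toAdd 0, (x : Skew).coeff g.1, Subtype.ext ?_⟩
    change single g.1 ((x : Skew).coeff g.1) = incl ((x : Skew).coeff g.1) *
      (((firstAxisUnit (Multiplicative.ofAdd 1)) ^ (g.1.toAdd 0) : firstAxisSubringˣ)
        : firstAxisSubring)
    rw [← map_zpow, firstAxisUnit_coe, single_eq_incl_mul]
    congr 2
    have h0 : g.1.toAdd 1 = 0 := by
      by_contra h
      exact mem_support_iff.1 g.2 (x.2 _ h)
    apply Multiplicative.toAdd.injective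
    rw [toAdd_axis]
    funext i
    fin_cases i <;> simp [h0]

/-- Degrees in `ℤ²` add, so opposite second coordinates cancel. With `k = h⁻¹` this makes the second
generator normalise the subring, as the second skew Laurent extension requires. -/
lemma conj_mem_firstAxisSubring {h k : Grp} (hk : h.toAdd 1 + k.toAdd 1 = 0) {a : Skew}
    (ha : a ∈ firstAxisSubring) : (single h 1 * a * single k 1 : Skew) ∈ firstAxisSubring := by
  intro g hg
  rw [coeff_mul_single, coeff_single_mul, ha, smul_zero, mul_zero, zero_mul]
  simp only [toAdd_mul, toAdd_inv, Pi.add_apply, Pi.neg_apply]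
  intro h0
  exact hg (by linear_combination h0 + hk)

lemma single_mul_single_inv (h : Grp) : (single h 1 * single h⁻¹ 1 : Skew) = 1 := by
  rw [single_mul_single', mul_inv_cancel, map_one, mul_one]; rfl

lemma single_inv_mul_single (h : Grp) : (single h⁻¹ 1 * single h 1 : Skew) = 1 := by
  rw [single_mul_single', inv_mul_cancel, map_one, mul_one]; rfl

lemma exists_mul_single_eq (h : Grp) (a : firstAxisSubring) :
    ∃ a' : firstAxisSubring, (a : Skew) * single h 1 = single h 1 * (a' : Skew) :=
  ⟨⟨single h⁻¹ 1 * (a : Skew) * single h 1, conj_mem_firstAxisSubring (by simp) a.2⟩, by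
    rw [← mul_assoc, ← mul_assoc, single_mul_single_inv, one_mul]⟩

lemma exists_single_mul_eq (h : Grp) (a : firstAxisSubring) :
    ∃ a' : firstAxisSubring, single h 1 * (a : Skew) = (a' : Skew) * single h 1 :=
  ⟨⟨single h 1 * (a : Skew) * single h⁻¹ 1, conj_mem_firstAxisSubring (by simp) a.2⟩, by
    rw [mul_assoc _ (single h⁻¹ 1) (single h 1), single_inv_mul_single, mul_one]⟩

/-- The generators of the second axis, as units of `B`. -/
def secondAxisUnit : Multiplicative ℤ →* Skewˣ :=
  MonoidHom.toHomUnits ((SkewMonoidAlgebra.of Poly Grp).comp (axis 1))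

lemma secondAxisUnit_coe (n : Multiplicative ℤ) :
    (secondAxisUnit n : Skew) = single (axis 1 n) 1 := rfl

instance isNoetherianRing_skew : IsNoetherianRing Skew := by
  refine isNoetherianRing_of_skewLaurent firstAxisSubring.subtype
    (secondAxisUnit (Multiplicative.ofAdd 1)) (exists_mul_single_eq _) (exists_single_mul_eq _) ?_
  · refine eq_top_iff.2 fun x _ => ?_
    rw [skew_eq_sum x]
    refine sum_mem fun g _ => AddSubmonoid.subset_closure ⟨g.toAdd 1,
      ⟨single (axis 0 (Multiplicative.ofAdd (g.toAdd 0))) (x.coeff g),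
        single_mem_firstAxisSubring (by simp [toAdd_axis]) _⟩, ?_⟩
    rw [← map_zpow, secondAxisUnit_coe, Subring.subtype_apply, single_mul_single']
    simp only [map_one, mul_one]
    congr 1
    apply Multiplicative.toAdd.injective
    rw [toAdd_mul, toAdd_axis, toAdd_axis]
    funext i
    fin_cases i <;> simp


/-! ### Height one primes of `ℂ[x, y]` and translations -/

lemma ringKrullDim_poly : ringKrullDim Poly = 2 := by
  rw [MvPolynomial.ringKrullDim_of_isNoetherianRing, ringKrullDim_eq_zero_of_field]
  simp

/-- Otherwise `⊥ < P < Q < m` would be a chain of length three in a ring of dimension two. -/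
lemma isMaximal_of_bot_lt_lt {P Q : Ideal Poly} [hP : P.IsPrime] [hQ : Q.IsPrime] (h₀ : ⊥ < P)
    (h : P < Q) : Q.IsMaximal := by
  obtain ⟨m, hm, hQm⟩ := Q.exists_le_maximal hQ.ne_top
  rcases hQm.eq_or_lt with rfl | hlt
  · exact hm
  exfalso
  let p : LTSeries (PrimeSpectrum Poly) :=
    { length := 3
      toFun := ![⟨⊥, Ideal.isPrime_bot⟩, ⟨P, hP⟩, ⟨Q, hQ⟩, ⟨m, hm.isPrime⟩]
      step := by
        intro i
        fin_cases i
        · exact h₀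
        · exact h
        · exact hlt }
  have h3 : (p.length : WithBot ℕ∞) ≤ ringKrullDim Poly := Order.LTSeries.length_le_krullDim p
  rw [ringKrullDim_poly] at h3
  have : p.length = 3 := rfl
  rw [this] at h3
  exact absurd h3 (by decide)

lemma isPrime_span_irreducible {f : Poly} (hf : Irreducible f) : (Ideal.span {f}).IsPrime :=
  (Ideal.span_singleton_prime hf.ne_zero).2 hf.prime

lemma bot_lt_span_irreducible {f : Poly} (hf : Irreducible f) : (⊥ : Ideal Poly) < Ideal.span {f} :=
  bot_lt_iff_ne_bot.2 fun h => hf.ne_zero (Ideal.span_singleton_eq_bot.1 h)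

lemma exists_irreducible_eq_span {I : Ideal Poly} (hprime : I.IsPrime) (hmax : ¬ I.IsMaximal)
    (hbot : I ≠ ⊥) : ∃ f : Poly, Irreducible f ∧ I = Ideal.span {f} := by
  obtain ⟨f, hfI, hf⟩ := hprime.exists_mem_prime_of_ne_bot hbot
  refine ⟨f, hf.irreducible, ?_⟩
  have := isPrime_span_irreducible hf.irreducible
  have hle : Ideal.span {f} ≤ I := (Ideal.span_singleton_le_iff_mem I).2 hfI
  rcases hle.eq_or_lt with h | h
  · exact h.symm
  · exact absurd (isMaximal_of_bot_lt_lt (bot_lt_span_irreducible hf.irreducible) h) hmax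

/-- A prime ideal containing two coprime polynomials is the ideal of a point. -/
lemma exists_eq_vanishingIdeal_of_mem {f a : Poly} (hf : Irreducible f) (ha : ¬ f ∣ a)
    {P : Ideal Poly} (hP : P.IsPrime) (hfP : f ∈ P) (haP : a ∈ P) :
    ∃ b : Fin 2 → ℂ, P = MvPolynomial.vanishingIdeal ℂ {b} := by
  rw [← MvPolynomial.isMaximal_iff_eq_vanishingIdeal_singleton]
  have := isPrime_span_irreducible hf
  refine isMaximal_of_bot_lt_lt (bot_lt_span_irreducible hf)
    (lt_of_le_of_ne ((Ideal.span_singleton_le_iff_mem P).2 hfP) ?_)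
  rintro rfl
  exact ha (Ideal.mem_span_singleton.1 haP)

lemma aeval_translate (v : Fin 2 → ℂ) (a : Fin 2 → ℤ) (p : Poly) :
    MvPolynomial.aeval v (translate a p) = MvPolynomial.aeval (fun i => v i + (a i : ℂ)) p := by
  have : (MvPolynomial.aeval v).comp (translate a) =
      (MvPolynomial.aeval (fun i => v i + (a i : ℂ)) : Poly →ₐ[ℂ] ℂ) := by
    apply MvPolynomial.algHom_ext
    intro i
    rw [AlgHom.comp_apply, translate_X]
    simp [MvPolynomial.aeval_def]
  exact DFunLike.congr_fun this p

lemma translate_translate (a b : Fin 2 → ℤ) (p : Poly) :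
    translate a (translate b p) = translate (a + b) p := by
  rw [translate_add]; rfl

lemma translate_neg_translate (a : Fin 2 → ℤ) (p : Poly) : translate (-a) (translate a p) = p := by
  rw [translate_translate, neg_add_cancel, translate_zero]; rfl

lemma translate_translate_neg (a : Fin 2 → ℤ) (p : Poly) : translate a (translate (-a) p) = p := by
  rw [translate_translate, add_neg_cancel, translate_zero]; rfl

lemma exists_aeval_eq_zero {f : Poly} (hf : ¬ IsUnit f) :
    ∃ v : Fin 2 → ℂ, MvPolynomial.aeval v f = 0 := by
  obtain ⟨m, hm, hle⟩ := (Ideal.span {f}).exists_le_maximal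
    (by rwa [Ne, Ideal.span_singleton_eq_top])
  obtain ⟨v, rfl⟩ := MvPolynomial.isMaximal_iff_eq_vanishingIdeal_singleton.1 hm
  exact ⟨v, hle (Ideal.mem_span_singleton_self f) v rfl⟩

/-- A polynomial whose zero set is invariant under translation by `a` vanishes on the lines
in direction `a` through its zeros. -/
lemma aeval_line_eq_zero {f : Poly} {a : Fin 2 → ℤ} (h : f ∣ translate a f) {v : Fin 2 → ℂ}
    (hv : MvPolynomial.aeval v f = 0) (t : ℂ) :
    MvPolynomial.aeval (fun i => v i + t * (a i : ℂ)) f = 0 := by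
  have hn : ∀ n : ℕ, MvPolynomial.aeval (fun i => v i + (n : ℂ) * (a i : ℂ)) f = 0 := by
    intro n
    induction n with
    | zero => simpa using hv
    | succ n ih =>
      obtain ⟨c, hc⟩ := h
      have := aeval_translate (fun i => v i + (n : ℂ) * (a i : ℂ)) a f
      rw [hc, map_mul, ih, zero_mul] at this
      rw [this]
      congr 2
      funext i
      push_cast
      ring
  -- The restriction of `f` to the line, which vanishes at every natural number and hence
  -- identically.
  let q : Polynomial ℂ := MvPolynomial.aeval
    (fun i => Polynomial.C (v i) + Polynomial.X * Polynomial.C (a i : ℂ)) f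
  have hq : ∀ s : ℂ, q.eval s = MvPolynomial.aeval (fun i => v i + s * (a i : ℂ)) f := by
    intro s
    have : (Polynomial.aeval s).comp (MvPolynomial.aeval
        (fun i => Polynomial.C (v i) + Polynomial.X * Polynomial.C (a i : ℂ))) =
        (MvPolynomial.aeval (fun i => v i + s * (a i : ℂ)) : Poly →ₐ[ℂ] ℂ) := by
      apply MvPolynomial.algHom_ext
      intro i
      simp
    rw [← this, AlgHom.comp_apply, Polynomial.coe_aeval_eq_eval]
  have hq0 : q = 0 := by
    refine Polynomial.eq_zero_of_infinite_isRoot q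
      ((Set.infinite_range_of_injective (Nat.cast_injective (R := ℂ))).mono ?_)
    rintro _ ⟨n, rfl⟩
    exact (hq n).trans (hn n)
  rw [← hq, hq0, Polynomial.eval_zero]

/-- An irreducible polynomial dividing a translate of itself defines a line of rational slope. -/
theorem not_dvd_translate {f : Poly} (hf : Irreducible f)
    (hline : ¬ IsRationalLine (Ideal.span {f})) {a : Fin 2 → ℤ} (ha : a ≠ 0) :
    ¬ f ∣ translate a f := by
  intro h
  apply hline
  obtain ⟨v, hv⟩ := exists_aeval_eq_zero hf.not_isUnit
  have ha' : a 1 ≠ 0 ∨ a 0 ≠ 0 := by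
    by_contra! hc
    apply ha
    funext i
    fin_cases i
    · exact hc.2
    · exact hc.1
  -- The line through the zero `v` of `f` in direction `a`.
  refine ⟨a 1, a 0, (a 1 : ℂ) * v 0 - (a 0 : ℂ) * v 1, ha', ?_⟩
  set l : Poly := MvPolynomial.C ((a 1 : ℤ) : ℂ) * MvPolynomial.X 0
    - MvPolynomial.C ((a 0 : ℤ) : ℂ) * MvPolynomial.X 1
    - MvPolynomial.C ((a 1 : ℂ) * v 0 - (a 0 : ℂ) * v 1) with hl
  have aeval_l : ∀ w : Fin 2 → ℂ, MvPolynomial.aeval w l =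
      (a 1 : ℂ) * w 0 - (a 0 : ℂ) * w 1 - ((a 1 : ℂ) * v 0 - (a 0 : ℂ) * v 1) := by
    intro w
    simp [hl, MvPolynomial.aeval_def]
  have hrad : f ∈ (Ideal.span {l}).radical := by
    rw [← MvPolynomial.vanishingIdeal_zeroLocus_eq_radical (K := ℂ)]
    intro w hw
    have hw0 : MvPolynomial.aeval w l = 0 := hw l (Ideal.mem_span_singleton_self l)
    rw [aeval_l] at hw0
    obtain ⟨t, ht0, ht1⟩ : ∃ t : ℂ, w 0 = v 0 + t * a 0 ∧ w 1 = v 1 + t * a 1 := by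
      rcases ha' with h1 | h0
      · have h1' : (a 1 : ℂ) ≠ 0 := Int.cast_ne_zero.2 h1
        refine ⟨(w 1 - v 1) / a 1, ?_, by field_simp; ring⟩
        field_simp
        linear_combination hw0
      · have h0' : (a 0 : ℂ) ≠ 0 := Int.cast_ne_zero.2 h0
        refine ⟨(w 0 - v 0) / a 0, by field_simp; ring, ?_⟩
        field_simp
        linear_combination -hw0
    have : w = fun i => v i + t * (a i : ℂ) := by
      funext i
      fin_cases i
      · exact ht0
      · exact ht1
    rw [this]
    exact aeval_line_eq_zero h hv t
  obtain ⟨n, hn⟩ := hrad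
  rw [Ideal.mem_span_singleton] at hn
  -- By the Nullstellensatz `l` divides a power of the prime `f`, so it is associated to some `f ^
  -- i`. As `l` is not a unit, `f ∣ l`, and comparing total degrees makes the cofactor constant.
  obtain ⟨i, -, hi⟩ := (dvd_prime_pow hf.prime n).1 hn
  have l_unit : ¬ IsUnit l := by
    intro hu
    have := hu.map (MvPolynomial.aeval (R := ℂ) v)
    rw [aeval_l, sub_self] at this
    exact not_isUnit_zero this
  have l_ne : l ≠ 0 := by
    intro h0
    -- Moving off the line along its normal gives the value `a 1 ^ 2 + a 0 ^ 2`, which is not zero.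
    have := aeval_l fun i => v i + if i = 0 then (a 1 : ℂ) else - (a 0 : ℂ)
    rw [h0, map_zero] at this
    simp only [if_true, one_ne_zero, if_false] at this
    have h2 : ((a 1 ^ 2 + a 0 ^ 2 : ℤ) : ℂ) = 0 := by
      push_cast
      linear_combination -this
    rw [Int.cast_eq_zero] at h2
    rcases ha' with h | h <;> have := sq_pos_of_ne_zero h <;> nlinarith [sq_nonneg (a 0), sq_nonneg (a 1)]
  have hfl : f ∣ l := by
    rcases Nat.eq_zero_or_pos i with rfl | hpos
    · rw [pow_zero, associated_one_iff_isUnit] at hi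
      exact absurd hi l_unit
    · exact (dvd_pow_self f hpos.ne').trans hi.symm.dvd
  obtain ⟨c, hc⟩ := hfl
  have hc0 : c ≠ 0 := by rintro rfl; exact l_ne (by rw [hc, mul_zero])
  have hdeg := MvPolynomial.totalDegree_mul_of_isDomain hf.ne_zero hc0
  rw [← hc] at hdeg
  have hdeg1 : l.totalDegree ≤ 1 := by
    refine (MvPolynomial.totalDegree_sub _ _).trans (max_le
      ((MvPolynomial.totalDegree_sub _ _).trans (max_le ?_ ?_))
      (by rw [MvPolynomial.totalDegree_C]; exact zero_le_one))
    · exact (MvPolynomial.totalDegree_mul _ _).trans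
        (by rw [MvPolynomial.totalDegree_C, MvPolynomial.totalDegree_X])
    · exact (MvPolynomial.totalDegree_mul _ _).trans
        (by rw [MvPolynomial.totalDegree_C, MvPolynomial.totalDegree_X])
  have hfdeg : f.totalDegree ≠ 0 := by
    intro h0
    have hC := MvPolynomial.totalDegree_eq_zero_iff_eq_C.1 h0
    apply hf.not_isUnit
    rw [hC]
    refine (isUnit_iff_ne_zero.2 ?_).map MvPolynomial.C
    intro h00
    rw [h00, map_zero] at hC
    exact hf.ne_zero hC
  have hC := MvPolynomial.totalDegree_eq_zero_iff_eq_C.1 (show c.totalDegree = 0 by omega)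
  have hcu : IsUnit c := by
    rw [hC]
    refine (isUnit_iff_ne_zero.2 ?_).map MvPolynomial.C
    intro h00
    rw [h00, map_zero] at hC
    exact hc0 hC
  rw [hc, Ideal.span_singleton_mul_right_unit hcu]


/-! ### Torsion in noetherian `B`-modules -/

/-- For each `j ≠ i` choose an element of `P j` outside `P i`. Their product kills every term but
the `i`-th and lies outside the prime `P i`. This is the independence of the translates `g v` inside
`B v`. -/
lemma mem_of_sum_smul_eq_zero {R M ι : Type*} [CommRing R] [AddCommGroup M] [Module R M]
    {e : ι → M} {P : ι → Ideal R} (hP : ∀ i, (P i).IsPrime) (hann : ∀ i c, c • e i = 0 ↔ c ∈ P i)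
    (hne : ∀ i j, i ≠ j → ¬ P j ≤ P i) {s : Finset ι} {c : ι → R}
    (h : ∑ i ∈ s, c i • e i = 0) {i : ι} (hi : i ∈ s) : c i ∈ P i := by
  classical
  have hp : ∀ j, ∃ p, j ≠ i → p ∈ P j ∧ p ∉ P i := by
    intro j
    by_cases hj : j = i
    · exact ⟨0, fun h => absurd hj h⟩
    · obtain ⟨p, hp⟩ := SetLike.not_le_iff_exists.1 (hne i j (Ne.symm hj))
      exact ⟨p, fun _ => hp⟩
  choose p hp using hp
  have hprod : ∏ j ∈ s.erase i, p j ∉ P i := by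
    rw [(hP i).prod_mem_iff]
    rintro ⟨j, hj, hjP⟩
    exact (hp j (Finset.ne_of_mem_erase hj)).2 hjP
  have h2 : ((∏ j ∈ s.erase i, p j) * c i) • e i = 0 := by
    have h3 := congrArg (fun x => (∏ j ∈ s.erase i, p j) • x) h
    simp only [smul_zero, Finset.smul_sum] at h3
    rw [Finset.sum_eq_single_of_mem i hi] at h3
    · rwa [mul_smul]
    · intro j hj hji
      have hjs : j ∈ s.erase i := Finset.mem_erase.2 ⟨hji, hj⟩
      rw [← mul_smul, hann]
      exact (P j).mul_mem_right _ ((P j).mem_of_dvd (Finset.dvd_prod_of_mem p hjs) (hp j hji).1)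
  rw [hann] at h2
  exact ((hP i).mem_or_mem h2).resolve_left hprod

section Modules

variable {M : Type*} [AddCommGroup M] [Module Skew M] [Module Poly M] [IsScalarTower Poly Skew M]

lemma incl_smul (c : Poly) (m : M) : incl c • m = c • m := by
  have : incl c = c • (1 : Skew) := by
    rw [one_def, smul_single, smul_eq_mul, mul_one, incl_apply]
  rw [this, smul_assoc, one_smul]

lemma single_smul_eq (g : Grp) (c : Poly) (m : M) :
    (single g c : Skew) • m = c • (single g 1 : Skew) • m := by
  rw [single_eq_incl_mul, mul_smul, incl_smul]

lemma smul_single_smul (g : Grp) (c : Poly) (m : M) :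
    c • (single g 1 : Skew) • m = (single g 1 : Skew) • translate (-g.toAdd) c • m := by
  rw [← incl_smul, ← incl_smul, ← mul_smul, ← mul_smul, incl_apply, incl_apply,
    single_mul_single', single_mul_single', translate_translate_neg]
  simp

lemma single_smul_eq_zero {M : Type*} [AddCommGroup M] [Module Skew M] (g : Grp) {m : M} : (single g 1 : Skew) • m = 0 ↔ m = 0 := by
  refine ⟨fun h => ?_, fun h => by rw [h, smul_zero]⟩
  rw [← one_smul Skew m, ← single_inv_mul_single g, mul_smul, h, smul_zero]

/-- The `f`-torsion of a `B`-submodule, as a `ℂ[x, y]`-submodule. -/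
def torsionIn (f : Poly) (L : Submodule Skew M) : Submodule Poly M :=
  L.restrictScalars Poly ⊓ Submodule.torsionBy Poly M f

lemma mem_torsionIn {f : Poly} {L : Submodule Skew M} {m : M} :
    m ∈ torsionIn f L ↔ m ∈ L ∧ f • m = 0 := Iff.rfl

/-- The ideal of the polynomials whose translate by `-g` lies in `P`. -/
def translateIdeal (P : Ideal Poly) (g : Grp) : Ideal Poly := P.comap (translate (-g.toAdd))

lemma mem_translateIdeal {P : Ideal Poly} {g : Grp} {c : Poly} :
    c ∈ translateIdeal P g ↔ translate (-g.toAdd) c ∈ P := Iff.rfl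

/-- Undoing the translation by `g` reduces incomparability of two translates to the comparison of
`P` with its translate by `g - h`. -/
lemma not_translateIdeal_le {P : Ideal Poly}
    (hne : ∀ a : Fin 2 → ℤ, a ≠ 0 → ¬ P.comap (translate a) ≤ P) {g h : Grp} (hgh : g ≠ h) :
    ¬ translateIdeal P h ≤ translateIdeal P g := by
  intro hle
  refine hne (g.toAdd - h.toAdd) (fun h0 => hgh ?_) fun c hc => ?_
  · exact Multiplicative.toAdd.injective (sub_eq_zero.1 h0)
  · have hmem : translate g.toAdd c ∈ translateIdeal P h := by
      rw [mem_translateIdeal, translate_translate, neg_add_eq_sub]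
      exact hc
    have := mem_translateIdeal.1 (hle hmem)
    rwa [translate_neg_translate] at this

lemma smul_single_smul_eq_zero {v : M} {P : Ideal Poly} (hann : ∀ c : Poly, c • v = 0 ↔ c ∈ P)
    (g : Grp) (c : Poly) : c • (single g 1 : Skew) • v = 0 ↔ c ∈ translateIdeal P g := by
  rw [smul_single_smul, single_smul_eq_zero, hann, mem_translateIdeal]

lemma smul_eq_sum (b : Skew) (v : M) :
    b • v = ∑ g ∈ b.support, b.coeff g • (single g 1 : Skew) • v := by
  conv_lhs => rw [skew_eq_sum b]
  rw [Finset.sum_smul]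
  exact Finset.sum_congr rfl fun g _ => single_smul_eq _ _ _

/-- If the annihilator of `v` is a prime whose translates are pairwise incomparable and only
finitely many of them contain `f`, then the `f`-torsion of `B v` is finitely generated. -/
theorem torsionIn_span_singleton_fg {f : Poly} {v : M} {P : Ideal Poly} (hP : P.IsPrime)
    (hann : ∀ c : Poly, c • v = 0 ↔ c ∈ P)
    (hne : ∀ a : Fin 2 → ℤ, a ≠ 0 → ¬ P.comap (translate a) ≤ P)
    (hfin : {a : Fin 2 → ℤ | translate a f ∈ P}.Finite) :
    (torsionIn f (Submodule.span Skew {v})).FG := by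
  have hQ : ∀ g, (translateIdeal P g).IsPrime := fun g => hP.comap _
  have hZ : {g : Grp | f ∈ translateIdeal P g}.Finite :=
    Set.Finite.of_finite_image (f := fun g : Grp => -g.toAdd)
      (hfin.subset (Set.image_subset_iff.2 fun g hg => mem_translateIdeal.1 hg))
      fun g _ h _ hgh => Multiplicative.toAdd.injective (neg_injective hgh)
  refine Submodule.FG.of_le (Submodule.fg_span (R := Poly)
    (hZ.image fun g => (single g 1 : Skew) • v)) fun x hx => ?_
  obtain ⟨hxL, hfx⟩ := mem_torsionIn.1 hx
  obtain ⟨b, rfl⟩ := Submodule.mem_span_singleton.1 hxL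
  rw [smul_eq_sum, Finset.smul_sum] at hfx
  simp only [smul_smul f] at hfx
  rw [smul_eq_sum]
  refine Submodule.sum_mem _ fun g hg => ?_
  have hmem := mem_of_sum_smul_eq_zero hQ (smul_single_smul_eq_zero hann)
    (fun g h => not_translateIdeal_le hne) hfx hg
  rcases (hQ g).mem_or_mem hmem with h | h
  · exact Submodule.smul_mem _ _ (Submodule.subset_span ⟨g, h, rfl⟩)
  · rw [(smul_single_smul_eq_zero hann g _).2 h]
    exact Submodule.zero_mem _

/-- A module with non-zero `f`-torsion has a non-zero submodule whose `f`-torsion is finitely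
generated over `ℂ[x, y]`. -/
theorem exists_ne_bot_torsionIn_fg {f : Poly} (hf : Irreducible f)
    (hline : ¬ IsRationalLine (Ideal.span {f})) (hfin : FiniteOnCosets (Ideal.span {f}))
    {v : M} (hv : v ≠ 0) (hfv : f • v = 0) :
    ∃ N : Submodule Skew M, N ≠ ⊥ ∧ (torsionIn f N).FG := by
  obtain ⟨P, hass, hle⟩ := exists_le_isAssociatedPrime_of_isNoetherianRing Poly v hv
  obtain ⟨hP, w, rfl⟩ := isAssociatedPrime_iff.1 hass
  set P : Ideal Poly := (⊥ : Submodule Poly M).colon {w} with hPdef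
  have hann : ∀ c : Poly, c • w = 0 ↔ c ∈ P := by
    intro c
    rw [hPdef, Submodule.mem_colon_singleton, Submodule.mem_bot]
  have hfP : f ∈ P := hle (by rwa [Submodule.mem_colon_singleton, Submodule.mem_bot])
  have hw : w ≠ 0 := by
    rintro rfl
    exact hP.ne_top ((Ideal.eq_top_iff_one _).2 ((hann 1).1 (smul_zero _)))
  refine ⟨Submodule.span Skew {w}, by rwa [Ne, Submodule.span_singleton_eq_bot], ?_⟩
  -- Either `P = (f)`, and only the trivial translate of `f` lies in `P`, or `P` is the ideal of a
  -- point `b`, and `translate a f ∈ P` means that `b + a` lies on the curve.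
  by_cases hPf : P ≤ Ideal.span {f}
  · have hPeq : P = Ideal.span {f} :=
      le_antisymm hPf ((Ideal.span_singleton_le_iff_mem P).2 hfP)
    have hdvd : ∀ c, c ∈ P ↔ f ∣ c := fun c => by rw [hPeq, Ideal.mem_span_singleton]
    refine torsionIn_span_singleton_fg hP hann (fun a ha h => ?_) ?_
    · have : translate (-a) f ∈ P := h (by
        rw [Ideal.mem_comap, translate_translate_neg]
        exact hfP)
      exact not_dvd_translate hf hline (neg_ne_zero.2 ha) ((hdvd _).1 this)
    · refine (Set.finite_singleton 0).subset fun a ha => ?_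
      by_contra h0
      exact not_dvd_translate hf hline h0 ((hdvd _).1 ha)
  · obtain ⟨a, haP, ha⟩ := SetLike.not_le_iff_exists.1 hPf
    rw [Ideal.mem_span_singleton] at ha
    obtain ⟨b, hb⟩ := exists_eq_vanishingIdeal_of_mem hf ha hP hfP haP
    have hmem : ∀ c, c ∈ P ↔ MvPolynomial.aeval b c = 0 := fun c => by
      rw [hb, MvPolynomial.mem_vanishingIdeal_singleton_iff]
    refine torsionIn_span_singleton_fg hP hann (fun a ha h => ha ?_) ?_
    · funext i
      -- This polynomial vanishes at `b + a`; vanishing at `b` as well forces `a i = 0`.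
      have : (MvPolynomial.X i - MvPolynomial.C (b i + (a i : ℂ)) : Poly) ∈ P := h (by
        rw [Ideal.mem_comap, hmem, aeval_translate]
        simp [MvPolynomial.aeval_def])
      rw [hmem] at this
      simpa [MvPolynomial.aeval_def] using this
    · refine Set.Finite.of_finite_image ((hfin b).subset ?_)
        (f := fun (a : Fin 2 → ℤ) (i : Fin 2) => b i + (a i : ℂ)) ?_
      · rintro _ ⟨a, ha, rfl⟩
        refine ⟨?_, a, rfl⟩
        rw [MvPolynomial.zeroLocus_span]
        rintro p rfl
        rw [← aeval_translate]
        exact (hmem _).1 ha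
      · intro a _ a' _ h
        funext i
        have := congrFun h i
        simpa using this

lemma torsionIn_comap_mkQ_fg {f : Poly} {L : Submodule Skew M} (hL : (torsionIn f L).FG)
    {N : Submodule Skew (M ⧸ L)} (hN : (torsionIn f N).FG) :
    (torsionIn f (N.comap L.mkQ)).FG := by
  let π : M →ₗ[Poly] M ⧸ L := L.mkQ.restrictScalars Poly
  refine Submodule.fg_of_fg_map_of_fg_inf_ker π (hN.of_le ?_) (hL.of_le ?_)
  · rintro _ ⟨m, hm, rfl⟩
    refine ⟨hm.1, ?_⟩
    have : f • m = 0 := hm.2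
    change f • π m = 0
    rw [← map_smul, this, map_zero]
  · rintro m ⟨hm, hker⟩
    exact ⟨(Submodule.Quotient.mk_eq_zero L).1 hker, hm.2⟩

/-- If `V(f)` meets every coset of `ℤ²` in a finite set, then the `f`-torsion of a noetherian
`B`-module is finitely generated over `ℂ[x, y]`. -/
theorem torsionBy_fg [IsNoetherian Skew M] {f : Poly} (hf : Irreducible f)
    (hline : ¬ IsRationalLine (Ideal.span {f})) (hfin : FiniteOnCosets (Ideal.span {f})) :
    (Submodule.torsionBy Poly M f).FG := by
  obtain ⟨L, hL, hmax⟩ := set_has_maximal_iff_noetherian.2 (inferInstance : IsNoetherian Skew M)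
    {L : Submodule Skew M | (torsionIn f L).FG}
    ⟨⊥, by
      have : torsionIn f (⊥ : Submodule Skew M) = ⊥ := eq_bot_iff.2 fun m hm => hm.1
      change (torsionIn f (⊥ : Submodule Skew M)).FG
      rw [this]
      exact Submodule.fg_bot⟩
  by_cases h : Submodule.torsionBy Poly M f ≤ L.restrictScalars Poly
  · exact Submodule.FG.of_le hL fun m hm => ⟨h hm, hm⟩
  · exfalso
    obtain ⟨v, hv, hvL⟩ := SetLike.not_le_iff_exists.1 h
    have hfv : f • L.mkQ v = 0 := by
      have hv' : f • v = 0 := hv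
      change f • (L.mkQ.restrictScalars Poly) v = 0
      rw [← map_smul, hv', map_zero]
    obtain ⟨N, hN, hNfg⟩ := exists_ne_bot_torsionIn_fg hf hline hfin
      (fun h0 => hvL ((Submodule.Quotient.mk_eq_zero L).1 h0)) hfv
    -- The preimage of `N` strictly contains `L` and still has finitely generated torsion, against
    -- the maximality of `L`.
    refine hmax _ (torsionIn_comap_mkQ_fg hL hNfg) (lt_of_le_of_ne ?_ fun heq => hN ?_)
    · intro m hm
      rw [Submodule.mem_comap, Submodule.mkQ_apply, (Submodule.Quotient.mk_eq_zero L).2 hm]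
      exact N.zero_mem
    · refine eq_bot_iff.2 fun x hx => ?_
      obtain ⟨m, rfl⟩ := L.mkQ_surjective x
      have : m ∈ N.comap L.mkQ := hx
      rw [← heq] at this
      exact (Submodule.Quotient.mk_eq_zero L).2 this

end Modules


/-! ### Structure of the idealisers -/

lemma coeff_incl_mul (c : Poly) (b : Skew) (g : Grp) : (incl c * b).coeff g = c * b.coeff g :=
  coeff_single_one_mul b c g

lemma coeff_mul_incl (b : Skew) (c : Poly) (g : Grp) :
    (b * incl c).coeff g = b.coeff g * translate g.toAdd c :=
  coeff_mul_single_one b c g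

lemma translate_injective (a : Fin 2 → ℤ) : Function.Injective (translate a) :=
  Function.LeftInverse.injective (translate_neg_translate a)

lemma incl_mul_left_cancel {f : Poly} (hf : f ≠ 0) {a b : Skew} (h : incl f * a = incl f * b) :
    a = b := by
  refine SkewMonoidAlgebra.ext fun g => mul_left_cancel₀ hf ?_
  rw [← coeff_incl_mul, ← coeff_incl_mul, h]

lemma mul_incl_right_cancel {f : Poly} (hf : f ≠ 0) {a b : Skew} (h : a * incl f = b * incl f) :
    a = b := by
  refine SkewMonoidAlgebra.ext fun g => mul_right_cancel₀
    ((map_ne_zero_iff _ (translate_injective g.toAdd)).2 hf) ?_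
  rw [← coeff_mul_incl, ← coeff_mul_incl, h]

lemma incl_mul_incl_mul (c d : Poly) (x : Skew) :
    incl c * (incl d * x) = incl d * (incl c * x) := by
  rw [← mul_assoc, ← map_mul, mul_comm c, map_mul, mul_assoc]

lemma exists_eq_incl_mul {f : Poly} {x : Skew} (h : ∀ g, f ∣ x.coeff g) :
    ∃ b, x = incl f * b := by
  choose d hd using h
  refine ⟨∑ g ∈ x.support, single g (d g), ?_⟩
  conv_lhs => rw [skew_eq_sum x]
  rw [Finset.mul_sum]
  refine Finset.sum_congr rfl fun g _ => ?_
  rw [incl_apply, single_mul_single', one_mul, toAdd_one, translate_zero, hd]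
  rfl

lemma mem_rightExt_span {f : Poly} {x : Skew} :
    x ∈ rightExt (Ideal.span {f}) ↔ ∃ b, x = incl f * b := by
  constructor
  · intro hx
    induction hx using Submodule.span_induction with
    | mem x hx =>
      obtain ⟨p, hp, rfl⟩ := hx
      obtain ⟨c, rfl⟩ := Ideal.mem_span_singleton.1 hp
      exact ⟨incl c, map_mul _ _ _⟩
    | zero => exact ⟨0, (mul_zero _).symm⟩
    | add x y _ _ hx hy =>
      obtain ⟨b, rfl⟩ := hx
      obtain ⟨c, rfl⟩ := hy
      exact ⟨b + c, (mul_add _ _ _).symm⟩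
    | smul a x _ hx =>
      obtain ⟨b, rfl⟩ := hx
      exact ⟨b * a.unop, mul_assoc _ _ _⟩
  · rintro ⟨b, rfl⟩
    exact Submodule.smul_mem _ (MulOpposite.op b)
      (Submodule.subset_span ⟨f, Ideal.mem_span_singleton_self f, rfl⟩)

lemma mem_leftExt_span {f : Poly} {x : Skew} :
    x ∈ leftExt (Ideal.span {f}) ↔ ∃ b, x = b * incl f := by
  constructor
  · intro hx
    induction hx using Submodule.span_induction with
    | mem x hx =>
      obtain ⟨p, hp, rfl⟩ := hx
      obtain ⟨c, rfl⟩ := Ideal.mem_span_singleton'.1 hp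
      exact ⟨incl c, map_mul _ _ _⟩
    | zero => exact ⟨0, (zero_mul _).symm⟩
    | add x y _ _ hx hy =>
      obtain ⟨b, rfl⟩ := hx
      obtain ⟨c, rfl⟩ := hy
      exact ⟨b + c, (add_mul _ _ _).symm⟩
    | smul a x _ hx =>
      obtain ⟨b, rfl⟩ := hx
      exact ⟨a * b, (mul_assoc _ _ _).symm⟩
  · rintro ⟨b, rfl⟩
    exact Submodule.smul_mem _ b
      (Submodule.subset_span ⟨f, Ideal.mem_span_singleton_self f, rfl⟩)

lemma mem_idealiser_iff {f : Poly} {a : Skew} :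
    a ∈ idealiser (rightExt (Ideal.span {f})) ↔ ∃ b, a * incl f = incl f * b := by
  constructor
  · intro h
    exact mem_rightExt_span.1 (h _ (mem_rightExt_span.2 ⟨1, (mul_one _).symm⟩))
  · rintro ⟨b, hb⟩ x hx
    obtain ⟨c, rfl⟩ := mem_rightExt_span.1 hx
    exact mem_rightExt_span.2 ⟨b * c, by rw [← mul_assoc, hb, mul_assoc]⟩

lemma mem_leftIdealiser_iff {f : Poly} {b : Skew} :
    b ∈ leftIdealiser (leftExt (Ideal.span {f})) ↔ ∃ a, incl f * b = a * incl f := by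
  constructor
  · intro h
    exact mem_leftExt_span.1 (h _ (mem_leftExt_span.2 ⟨1, (one_mul _).symm⟩))
  · rintro ⟨a, ha⟩ x hx
    obtain ⟨c, rfl⟩ := mem_leftExt_span.1 hx
    exact mem_leftExt_span.2 ⟨c * a, by rw [mul_assoc, ha, mul_assoc]⟩

lemma incl_mem_idealiser (f c : Poly) : incl c ∈ idealiser (rightExt (Ideal.span {f})) :=
  mem_idealiser_iff.2 ⟨incl c, by rw [← map_mul, ← map_mul, mul_comm]⟩

lemma incl_mul_mem_idealiser (f : Poly) (b : Skew) :
    incl f * b ∈ idealiser (rightExt (Ideal.span {f})) :=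
  mem_idealiser_iff.2 ⟨b * incl f, mul_assoc _ _ _⟩

/-- The coefficient of `a f` at `g` is `a_g` times a non-trivial translate of `f`, and the prime `f`
does not divide that translate. -/
lemma dvd_coeff_of_mem_idealiser {f : Poly} (hf : Irreducible f)
    (hline : ¬ IsRationalLine (Ideal.span {f})) {a : Skew}
    (ha : a ∈ idealiser (rightExt (Ideal.span {f}))) {g : Grp} (hg : g ≠ 1) : f ∣ a.coeff g := by
  obtain ⟨b, hb⟩ := mem_idealiser_iff.1 ha
  have h : f ∣ a.coeff g * translate g.toAdd f :=
    ⟨b.coeff g, by rw [← coeff_mul_incl, hb, coeff_incl_mul]⟩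
  exact (hf.prime.dvd_or_dvd h).resolve_right (not_dvd_translate hf hline hg)

lemma exists_eq_incl_add_incl_mul {f : Poly} (hf : Irreducible f)
    (hline : ¬ IsRationalLine (Ideal.span {f})) {a : Skew}
    (ha : a ∈ idealiser (rightExt (Ideal.span {f}))) : ∃ c b, a = incl c + incl f * b := by
  obtain ⟨b, hb⟩ := exists_eq_incl_mul (f := f) (x := a - incl (a.coeff 1)) fun g => by
    rw [coeff_sub, Finsupp.sub_apply, incl_apply]
    by_cases hg : g = 1
    · rw [hg, coeff_single, Finsupp.single_eq_same, sub_self]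
      exact dvd_zero f
    · rw [coeff_single, Finsupp.single_eq_of_ne hg, sub_zero]
      exact dvd_coeff_of_mem_idealiser hf hline ha hg
  exact ⟨_, b, by rw [← hb, add_sub_cancel]⟩

/-! ### Left noetherianity forces finiteness on cosets -/

/-- The left ideal `B m_b` generated by the maximal ideal of the point `b`. -/
def pointLeftIdeal (b : Fin 2 → ℂ) : Submodule Skew Skew where
  carrier := {x | ∀ g : Grp, MvPolynomial.aeval (fun i => b i - (g.toAdd i : ℂ)) (x.coeff g) = 0}
  add_mem' {x y} hx hy g := by rw [coeff_add, Finsupp.add_apply, map_add, hx, hy, add_zero]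
  zero_mem' g := by rw [coeff_zero, Finsupp.zero_apply, map_zero]
  smul_mem' c x hx g := by
    rw [smul_eq_mul, skew_eq_sum c, Finset.sum_mul]
    have key : ∀ h : Grp, MvPolynomial.aeval (fun i => b i - (g.toAdd i : ℂ))
        ((single h (c.coeff h) * x).coeff g) = 0 := by
      intro h
      rw [coeff_single_mul, map_mul]
      change _ * MvPolynomial.aeval _ (translate h.toAdd _) = 0
      rw [aeval_translate]
      convert mul_zero _
      convert hx (h⁻¹ * g) using 3
      simp only [toAdd_mul, toAdd_inv, Pi.add_apply, Pi.neg_apply]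
      push_cast
      funext i
      ring
    have hsum : ∀ s : Finset Grp, MvPolynomial.aeval (fun i => b i - (g.toAdd i : ℂ))
        ((∑ h ∈ s, single h (c.coeff h) * x).coeff g) = 0 := by
      classical
      intro s
      induction s using Finset.induction_on with
      | empty => rw [Finset.sum_empty, coeff_zero, Finsupp.zero_apply, map_zero]
      | insert h s hh ih =>
        rw [Finset.sum_insert hh, coeff_add, Finsupp.add_apply, map_add, key, ih, add_zero]
    exact hsum _

lemma mem_pointLeftIdeal {b : Fin 2 → ℂ} {x : Skew} : x ∈ pointLeftIdeal b ↔
    ∀ g : Grp, MvPolynomial.aeval (fun i => b i - (g.toAdd i : ℂ)) (x.coeff g) = 0 := Iff.rfl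

theorem finiteOnCosets_of_isLeftNoetherian {f : Poly} (hf : Irreducible f)
    (hline : ¬ IsRationalLine (Ideal.span {f}))
    (h : IsLeftNoetherian (idealiser (rightExt (Ideal.span {f})))) :
    FiniteOnCosets (Ideal.span {f}) := by
  classical
  intro b
  let R := idealiser (rightExt (Ideal.span {f}))
  -- The left ideal `f B ∩ B m_b` of `R`.
  let L : Ideal R :=
    { carrier := {r | ∃ x, (r : Skew) = incl f * x ∧ (r : Skew) ∈ pointLeftIdeal b}
      add_mem' := by
        rintro r s ⟨x, hx, hr⟩ ⟨y, hy, hs⟩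
        exact ⟨x + y, by rw [Subring.coe_add, hx, hy, mul_add], Submodule.add_mem _ hr hs⟩
      zero_mem' := ⟨0, (mul_zero _).symm, Submodule.zero_mem _⟩
      smul_mem' := by
        rintro a r ⟨x, hx, hr⟩
        obtain ⟨c, hc⟩ := mem_idealiser_iff.1 a.2
        exact ⟨c * x, by rw [smul_eq_mul, Subring.coe_mul, hx, ← mul_assoc, hc, mul_assoc],
          Submodule.smul_mem _ (a : Skew) hr⟩ }
  have : IsNoetherian R R := h
  obtain ⟨s, hs⟩ : L.FG := IsNoetherian.noetherian L
  have hsL : ∀ r ∈ s, ∃ x, (r : Skew) = incl f * x ∧ (r : Skew) ∈ pointLeftIdeal b :=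
    fun r hr => (hs ▸ Submodule.subset_span hr : r ∈ L)
  choose! x hx hxK using hsL
  let T : Finset Grp := s.biUnion fun r => (x r).support
  -- Modulo `f B m_b`, the cofactor of `f` stays supported in `T`. For scalars write `a = c + f d`:
  -- the `c` part preserves supports, while `f d r` falls into `f B m_b` because `r ∈ B m_b`.
  have key : ∀ r ∈ L, ∃ y k, (r : Skew) = incl f * (y + k) ∧ (∀ g ∉ T, y.coeff g = 0) ∧
      k ∈ pointLeftIdeal b := by
    intro r hr
    rw [← hs] at hr
    induction hr using Submodule.span_induction with
    | mem r hr =>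
      refine ⟨x r, 0, by rw [add_zero]; exact hx r hr, fun g hg => ?_, Submodule.zero_mem _⟩
      by_contra h0
      exact hg (Finset.mem_biUnion.2 ⟨r, hr, mem_support_iff.2 h0⟩)
    | zero => exact ⟨0, 0, by rw [add_zero, mul_zero]; rfl, fun _ _ => rfl, Submodule.zero_mem _⟩
    | add r s _ _ hr hs =>
      obtain ⟨y, k, hr, hy, hk⟩ := hr
      obtain ⟨y', k', hs, hy', hk'⟩ := hs
      refine ⟨y + y', k + k', ?_, fun g hg => ?_, Submodule.add_mem _ hk hk'⟩
      · rw [Subring.coe_add, hr, hs, ← mul_add, add_add_add_comm]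
      · rw [coeff_add, Finsupp.add_apply, hy g hg, hy' g hg, add_zero]
    | smul a r hr' hr =>
      obtain ⟨y, k, hr, hy, hk⟩ := hr
      obtain ⟨c, d, ha⟩ := exists_eq_incl_add_incl_mul hf hline a.2
      have hrL : r ∈ L := hs ▸ hr'
      have hrK : (r : Skew) ∈ pointLeftIdeal b := hrL.choose_spec.2
      refine ⟨incl c * y, incl c * k + d * (r : Skew), ?_, fun g hg => ?_,
        Submodule.add_mem _ (Submodule.smul_mem _ (incl c) hk) (Submodule.smul_mem _ d hrK)⟩
      · change (a : Skew) * (r : Skew) = _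
        rw [ha, add_mul, mul_assoc (incl f), ← add_assoc, ← mul_add, mul_add (incl f)]
        refine congrArg (· + incl f * (d * (r : Skew))) ?_
        rw [hr, incl_mul_incl_mul]
      · rw [coeff_incl_mul, hy g hg, mul_zero]
  refine ((T.finite_toSet.image fun (g : Grp) (i : Fin 2) => b i - (g.toAdd i : ℂ))).subset ?_
  rintro _ ⟨hV, a, rfl⟩
  -- The sign is reversed because membership in `B m_b` tests the coefficient of `g` at `b - g`.
  refine ⟨Multiplicative.ofAdd (-a), ?_, by funext i; simp⟩
  by_contra hT
  set g : Grp := Multiplicative.ofAdd (-a) with hg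
  have hfg : MvPolynomial.aeval (fun i => b i - (g.toAdd i : ℂ)) f = 0 := by
    have := hV f (Ideal.mem_span_singleton_self f)
    simpa [hg] using this
  have hmem : (⟨incl f * single g 1, incl_mul_mem_idealiser f _⟩ : R) ∈ L := by
    refine ⟨single g 1, rfl, mem_pointLeftIdeal.2 fun h => ?_⟩
    change MvPolynomial.aeval _ ((incl f * (single g 1 : Skew)).coeff h) = 0
    rw [coeff_incl_mul, map_mul, coeff_single]
    by_cases hh : h = g
    · rw [hh, hfg, zero_mul]
    · rw [Finsupp.single_eq_of_ne hh, map_zero, mul_zero]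
  obtain ⟨y, k, hyk, hy, hk⟩ := key _ hmem
  have h1 : single g 1 = y + k := incl_mul_left_cancel hf.ne_zero hyk
  have h2 := hk g
  have h3 : k.coeff g = 1 := by
    have := congrArg (fun z : Skew => z.coeff g) h1
    simp only [coeff_add, Finsupp.add_apply, coeff_single, Finsupp.single_eq_same] at this
    rw [hy g hT, zero_add] at this
    exact this.symm
  rw [h3, map_one] at h2
  exact one_ne_zero h2

/-! ### Finiteness on cosets implies left noetherianity -/

/-- Lifts generators of an image to elements of `S` itself, so that `S` is controlled up to the
kernel of `π`. -/
lemma exists_fg_le_of_map_fg {R M N : Type*} [Ring R] [AddCommGroup M] [AddCommGroup N]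
    [Module R M] [Module R N] (π : M →ₗ[R] N) {S : Submodule R M} (h : (S.map π).FG) :
    ∃ D ≤ S, D.FG ∧ ∀ x ∈ S, ∃ d ∈ D, π x = π d := by
  classical
  obtain ⟨t, ht⟩ := h
  have hsub : (t : Set N) ⊆ π '' S := by
    rw [← Submodule.map_coe, ← ht]
    exact Submodule.subset_span
  obtain ⟨t', ht'S, rfl⟩ := Finset.subset_set_image_iff.1 hsub
  refine ⟨Submodule.span R t', Submodule.span_le.2 ht'S, ⟨t', rfl⟩, fun x hx => ?_⟩
  have : π x ∈ S.map π := ⟨x, hx, rfl⟩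
  rw [← ht, Finset.coe_image, ← Submodule.map_span] at this
  obtain ⟨d, hd, hdx⟩ := this
  exact ⟨d, hd, hdx.symm⟩

lemma smul_eq_incl_mul (c : Poly) (b : Skew) : c • b = incl c * b := by
  rw [← incl_smul, smul_eq_mul]

/-- A left ideal of the idealiser of `f B`, as a `ℂ[x, y]`-submodule of `B`. -/
def idealiserIdealToPoly {f : Poly} (K : Ideal (idealiser (rightExt (Ideal.span {f})))) :
    Submodule Poly Skew where
  carrier := {x | ∃ r ∈ K, (r : Skew) = x}
  add_mem' := by
    rintro _ _ ⟨r, hr, rfl⟩ ⟨s, hs, rfl⟩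
    exact ⟨r + s, K.add_mem hr hs, rfl⟩
  zero_mem' := ⟨0, K.zero_mem, rfl⟩
  smul_mem' := by
    rintro c _ ⟨r, hr, rfl⟩
    refine ⟨(⟨incl c, incl_mem_idealiser f c⟩ : idealiser (rightExt (Ideal.span {f}))) * r,
      K.mul_mem_left _ hr, ?_⟩
    rw [Subring.coe_mul, smul_eq_incl_mul]

/-- The coefficient of the identity of `ℤ²`, as a linear map. -/
def coeffOne : Skew →ₗ[Poly] Poly where
  toFun x := x.coeff 1
  map_add' x y := by rw [coeff_add, Finsupp.add_apply]
  map_smul' c x := by rw [coeff_smul, Finsupp.smul_apply, RingHom.id_apply]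

/-- Left multiplication by a polynomial, as a linear map. -/
def inclMulLeft (f : Poly) : Skew →ₗ[Poly] Skew where
  toFun x := incl f * x
  map_add' := mul_add _
  map_smul' c x := by
    rw [smul_eq_incl_mul, incl_mul_incl_mul, RingHom.id_apply, smul_eq_incl_mul]

theorem isLeftNoetherian_of_finiteOnCosets {f : Poly} (hf : Irreducible f)
    (hline : ¬ IsRationalLine (Ideal.span {f})) (hfin : FiniteOnCosets (Ideal.span {f})) :
    IsLeftNoetherian (idealiser (rightExt (Ideal.span {f}))) := by
  classical
  let R := idealiser (rightExt (Ideal.span {f}))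
  change IsNoetherian R R
  refine isNoetherian_def.2 fun K => ?_
  let toPoly : Ideal R → Submodule Poly Skew := idealiserIdealToPoly
  -- a finite set of generators of `B K` inside `K`
  obtain ⟨s, hsK, hs⟩ := (Submodule.fg_span_iff_fg_span_finset_subset
    ((fun r : R => (r : Skew)) '' (K : Set R))).1
    (IsNoetherian.noetherian (Submodule.span Skew ((fun r : R => (r : Skew)) '' (K : Set R))))
  obtain ⟨s, hsK', rfl⟩ := Finset.subset_set_image_iff.1 hsK
  set K' : Submodule Skew Skew := Submodule.span Skew ((fun r : R => (r : Skew)) '' (K : Set R))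
  -- The factor `f` turns arbitrary coefficients from `B` into coefficients from `R`, since `f B ⊆
  -- R`.
  have hmul : ∀ k ∈ K', incl f * k ∈ toPoly (Submodule.span R (s : Set R)) := by
    intro k hk
    have hk' : ∀ b : Skew, incl f * (b * k) ∈ toPoly (Submodule.span R (s : Set R)) := by
      rw [hs] at hk
      induction hk using Submodule.span_induction with
      | mem x hx =>
        rw [Finset.coe_image] at hx
        obtain ⟨r, hr, rfl⟩ := hx
        intro b
        refine ⟨⟨incl f * b, incl_mul_mem_idealiser f b⟩ * r,
          Ideal.mul_mem_left _ _ (Submodule.subset_span hr), ?_⟩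
        rw [Subring.coe_mul, mul_assoc]
      | zero =>
        intro b
        rw [mul_zero, mul_zero]
        exact Submodule.zero_mem _
      | add x y _ _ hx hy =>
        intro b
        rw [mul_add, mul_add]
        exact Submodule.add_mem _ (hx b) (hy b)
      | smul a x _ hx =>
        intro b
        rw [smul_eq_mul, ← mul_assoc b]
        exact hx (b * a)
    simpa using hk' 1
  -- the image of `K` in `ℂ[x, y] / (f)`
  let π₁ : Skew →ₗ[Poly] Poly ⧸ Ideal.span {f} := (Submodule.mkQ (Ideal.span {f})).comp coeffOne
  obtain ⟨D₁, hD₁K, hD₁, h₁⟩ := exists_fg_le_of_map_fg π₁ (S := toPoly K)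
    (IsNoetherian.noetherian _)
  -- the `f`-torsion of `B / B K`
  let X : Submodule Poly Skew := (toPoly K).comap (inclMulLeft f)
  let π₂ : Skew →ₗ[Poly] Skew ⧸ K' := K'.mkQ.restrictScalars Poly
  obtain ⟨D₂, hD₂X, hD₂, h₂⟩ := exists_fg_le_of_map_fg π₂ (S := X)
    ((torsionBy_fg hf hline hfin).of_le (by
      rintro _ ⟨x, hx, rfl⟩
      change f • π₂ x = 0
      rw [← map_smul, smul_eq_incl_mul]
      refine (Submodule.Quotient.mk_eq_zero K').2 ?_
      obtain ⟨r, hr, hrx⟩ := hx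
      exact Submodule.subset_span ⟨r, hr, hrx⟩))
  obtain ⟨t₁, rfl⟩ := hD₁
  obtain ⟨t₂, rfl⟩ := hD₂
  have ht₁ : ∀ d ∈ t₁, ∃ r ∈ K, (r : Skew) = d := fun d hd => hD₁K (Submodule.subset_span hd)
  have ht₂ : ∀ d ∈ t₂, ∃ r ∈ K, (r : Skew) = incl f * d :=
    fun d hd => hD₂X (Submodule.subset_span hd)
  choose! r₁ hr₁K hr₁ using ht₁
  choose! r₂ hr₂K hr₂ using ht₂
  refine ⟨s ∪ (t₁.image r₁ ∪ t₂.image r₂), le_antisymm (Submodule.span_le.2 ?_) fun k hk => ?_⟩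
  · intro r hr
    simp only [Finset.coe_union, Finset.coe_image, Set.mem_union, Set.mem_image,
      Finset.mem_coe] at hr
    rcases hr with hr | ⟨d, hd, rfl⟩ | ⟨d, hd, rfl⟩
    · exact hsK' hr
    · exact hr₁K d hd
    · exact hr₂K d hd
  set E : Ideal R := Submodule.span R ((s ∪ (t₁.image r₁ ∪ t₂.image r₂) : Finset R) : Set R)
  have hsE : toPoly (Submodule.span R (s : Set R)) ≤ toPoly E := by
    rintro _ ⟨r, hr, rfl⟩
    exact ⟨r, Submodule.span_mono (by simp) hr, rfl⟩
  have hD₁E : Submodule.span Poly (t₁ : Set Skew) ≤ toPoly E := Submodule.span_le.2 fun d hd =>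
    ⟨r₁ d, Submodule.subset_span (by
      simp only [Finset.coe_union, Finset.coe_image]
      exact Or.inr (Or.inl ⟨d, hd, rfl⟩)), hr₁ d hd⟩
  have hD₂E : ∀ d ∈ Submodule.span Poly (t₂ : Set Skew), incl f * d ∈ toPoly E := by
    intro d hd
    induction hd using Submodule.span_induction with
    | mem d hd =>
      exact ⟨r₂ d, Submodule.subset_span (by
        simp only [Finset.coe_union, Finset.coe_image]
        exact Or.inr (Or.inr ⟨d, hd, rfl⟩)), hr₂ d hd⟩
    | zero => rw [mul_zero]; exact Submodule.zero_mem _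
    | add x y _ _ hx hy => rw [mul_add]; exact Submodule.add_mem _ hx hy
    | smul c x _ hx =>
      have : incl f * c • x = c • (incl f * x) := by
        rw [smul_eq_incl_mul, smul_eq_incl_mul, incl_mul_incl_mul]
      rw [this]
      exact Submodule.smul_mem _ _ hx
  -- Correcting the identity coefficient modulo `f` puts `k - d₁` in `f B`, say `f x`. Then `x` is
  -- corrected by `d₂` modulo `B K`, which gives `k = d₁ + f d₂ + f (x - d₂)` with all three terms
  -- in `E`.
  obtain ⟨d₁, hd₁, hkd₁⟩ := h₁ k ⟨k, hk, rfl⟩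
  have hsub : (k : Skew) - d₁ ∈ toPoly K := Submodule.sub_mem _ ⟨k, hk, rfl⟩ (hD₁K hd₁)
  obtain ⟨x, hx⟩ := exists_eq_incl_mul (f := f) (x := (k : Skew) - d₁) fun g => by
    by_cases hg : g = 1
    · rw [hg, coeff_sub, Finsupp.sub_apply, ← Ideal.mem_span_singleton]
      exact (Submodule.Quotient.eq (Ideal.span {f})).1 hkd₁
    · obtain ⟨r, -, hr⟩ := hsub
      rw [← hr]
      exact dvd_coeff_of_mem_idealiser hf hline r.2 hg
  obtain ⟨d₂, hd₂, hxd₂⟩ := h₂ x (by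
    change incl f * x ∈ toPoly K
    rwa [← hx])
  have hxK' : x - d₂ ∈ K' := (Submodule.Quotient.eq K').1 hxd₂
  have hkE : (k : Skew) ∈ toPoly E := by
    have : (k : Skew) = d₁ + (incl f * d₂ + incl f * (x - d₂)) := by
      rw [← mul_add, add_sub_cancel, ← hx, add_sub_cancel]
    rw [this]
    exact Submodule.add_mem _ (hD₁E hd₁) (Submodule.add_mem _ (hD₂E _ hd₂) (hsE (hmul _ hxK')))
  obtain ⟨r, hr, hrk⟩ := hkE
  rwa [← Subtype.ext hrk]


/-! ### The two idealisers are isomorphic -/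

/-- The relation `f b = a f` is symmetric in its two readings: it puts `a` in one idealiser and `b`
in the other. Each determines the other because multiplication by `f` is cancellable on both sides.
-/
theorem exists_idealiser_equiv {f : Poly} (hf : f ≠ 0) :
    ∃ θ : idealiser (rightExt (Ideal.span {f})) ≃+* leftIdealiser (leftExt (Ideal.span {f})),
      ∀ a, incl f * (θ a : Skew) = (a : Skew) * incl f := by
  have h₁ : ∀ a : idealiser (rightExt (Ideal.span {f})),
      ∃ b : leftIdealiser (leftExt (Ideal.span {f})), incl f * (b : Skew) = a * incl f := by
    intro a
    obtain ⟨b, hb⟩ := mem_idealiser_iff.1 a.2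
    exact ⟨⟨b, mem_leftIdealiser_iff.2 ⟨a, hb.symm⟩⟩, hb.symm⟩
  choose θ hθ using h₁
  let φ : idealiser (rightExt (Ideal.span {f})) →+* leftIdealiser (leftExt (Ideal.span {f})) :=
    { toFun := θ
      map_one' := Subtype.ext (incl_mul_left_cancel hf (by
        rw [hθ, Subring.coe_one, Subring.coe_one, one_mul, mul_one]))
      map_mul' := fun a b => Subtype.ext (incl_mul_left_cancel hf (by
        rw [hθ, Subring.coe_mul, Subring.coe_mul, ← mul_assoc, hθ, mul_assoc, mul_assoc, hθ]))
      map_zero' := Subtype.ext (incl_mul_left_cancel hf (by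
        rw [hθ, Subring.coe_zero, Subring.coe_zero, zero_mul, mul_zero]))
      map_add' := fun a b => Subtype.ext (incl_mul_left_cancel hf (by
        rw [hθ, Subring.coe_add, Subring.coe_add, add_mul, mul_add, hθ, hθ])) }
  refine ⟨RingEquiv.ofBijective φ ⟨fun a b hab => ?_, fun b => ?_⟩, hθ⟩
  · have hab' : θ a = θ b := hab
    exact Subtype.ext (mul_incl_right_cancel hf (by rw [← hθ, ← hθ, hab']))
  · obtain ⟨a, ha⟩ := mem_leftIdealiser_iff.1 b.2
    refine ⟨⟨a, mem_idealiser_iff.2 ⟨b, ha.symm⟩⟩, Subtype.ext (incl_mul_left_cancel hf ?_)⟩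
    exact (hθ _).trans ha.symm

/-! ### Left-right symmetry -/

/-- The map `g ↦ g⁻¹` into the opposite ring of `B`. -/
def invHom : Grp →* Skewᵐᵒᵖ where
  toFun g := MulOpposite.op (single g⁻¹ 1)
  map_one' := by rw [inv_one]; rfl
  map_mul' g h := by
    rw [← MulOpposite.op_mul, single_mul_single', map_one, mul_one, mul_inv_rev]

/-- The anti-automorphism of `B` which fixes `ℂ[x, y]` and inverts the elements of `ℤ²`. -/
def antiHom : Skew →+* Skewᵐᵒᵖ :=
  liftNCRingHom (incl.toOpposite fun c d => by rw [Commute, SemiconjBy, ← map_mul, mul_comm, map_mul])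
    invHom fun {c g} => by
      change MulOpposite.op (single g⁻¹ 1 * single 1 (translate g.toAdd c))
        = MulOpposite.op (single 1 c * single g⁻¹ 1)
      rw [single_mul_single', single_mul_single', toAdd_inv, translate_neg_translate, one_mul,
        mul_one, one_mul, map_one, mul_one]

lemma antiHom_single (g : Grp) (c : Poly) :
    antiHom (single g c) = MulOpposite.op (single g⁻¹ (translate (-g.toAdd) c)) := by
  have h : antiHom (single g c) = MulOpposite.op (single g⁻¹ 1 * single 1 c) :=
    liftNC_single _ _ _ _
  rw [h, single_mul_single', mul_one, one_mul, toAdd_inv]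

lemma antiHom_incl (c : Poly) : antiHom (incl c) = MulOpposite.op (incl c) := by
  rw [incl_apply, antiHom_single, inv_one, toAdd_one, neg_zero, translate_zero]
  rfl

lemma antiHom_antiHom (x : Skew) : (antiHom (antiHom x).unop).unop = x := by
  have : (AddEquiv.toAddMonoidHom MulOpposite.opAddEquiv.symm).comp
      (antiHom.toAddMonoidHom.comp ((AddEquiv.toAddMonoidHom MulOpposite.opAddEquiv.symm).comp
        antiHom.toAddMonoidHom)) = AddMonoidHom.id Skew := by
    refine addHom_ext fun g c => ?_
    change (antiHom (antiHom (single g c)).unop).unop = single g c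
    rw [antiHom_single, MulOpposite.unop_op, antiHom_single, MulOpposite.unop_op, inv_inv,
      toAdd_inv, neg_neg, translate_translate_neg]
  exact DFunLike.congr_fun this x

theorem exists_idealiser_equiv_op {f : Poly} (hf : f ≠ 0) :
    Nonempty (idealiser (rightExt (Ideal.span {f})) ≃+*
      (idealiser (rightExt (Ideal.span {f})))ᵐᵒᵖ) := by
  obtain ⟨θ, hθ⟩ := exists_idealiser_equiv hf
  let β : Skew → Skew := fun x => (antiHom x).unop
  have β_mul : ∀ x y, β (x * y) = β y * β x := fun x y => by
    simp only [β, map_mul, MulOpposite.unop_mul]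
  have β_incl : ∀ c, β (incl c) = incl c := fun c => by
    simp only [β, antiHom_incl, MulOpposite.unop_op]
  -- Applying the anti-automorphism to `f θ(a) = a f` reverses it into the membership criterion for
  -- the original idealiser.
  have hβ : ∀ a : idealiser (rightExt (Ideal.span {f})),
      β (θ a : Skew) * incl f = incl f * β a := by
    intro a
    have := congrArg β (hθ a)
    rwa [β_mul, β_mul, β_incl] at this
  let γ : idealiser (rightExt (Ideal.span {f})) →+* (idealiser (rightExt (Ideal.span {f})))ᵐᵒᵖ :=
    { toFun := fun a => MulOpposite.op ⟨β (θ a), mem_idealiser_iff.2 ⟨β a, hβ a⟩⟩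
      map_one' := by
        refine congrArg MulOpposite.op (Subtype.ext ?_)
        change (antiHom _).unop = 1
        rw [map_one, Subring.coe_one, map_one, MulOpposite.unop_one]
      map_mul' := fun a b => by
        refine congrArg MulOpposite.op (Subtype.ext ?_)
        change β _ = β _ * β _
        rw [map_mul, Subring.coe_mul, β_mul]
      map_zero' := by
        refine congrArg MulOpposite.op (Subtype.ext ?_)
        change (antiHom _).unop = 0
        rw [map_zero, Subring.coe_zero, map_zero, MulOpposite.unop_zero]
      map_add' := fun a b => by
        refine congrArg MulOpposite.op (Subtype.ext ?_)
        change (antiHom _).unop = (antiHom _).unop + (antiHom _).unop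
        rw [map_add, Subring.coe_add, map_add, MulOpposite.unop_add] }
  refine ⟨RingEquiv.ofBijective γ ⟨fun a b hab => ?_, fun r => ?_⟩⟩
  · have h : β (θ a : Skew) = β (θ b : Skew) :=
      congrArg (fun r : (idealiser (rightExt (Ideal.span {f})))ᵐᵒᵖ => (r.unop : Skew)) hab
    apply θ.injective
    apply Subtype.ext
    rw [← antiHom_antiHom (θ a : Skew), ← antiHom_antiHom (θ b : Skew)]
    exact congrArg β h
  · have hr : β (r.unop : Skew) ∈ leftIdealiser (leftExt (Ideal.span {f})) :=
      mem_leftIdealiser_iff.2 ⟨_, (hβ r.unop).symm⟩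
    refine ⟨θ.symm ⟨_, hr⟩, MulOpposite.unop_injective (Subtype.ext ?_)⟩
    change β (θ (θ.symm ⟨_, hr⟩) : Skew) = r.unop
    rw [RingEquiv.apply_symm_apply]
    exact antiHom_antiHom _

lemma isRightNoetherian_iff_of_equiv_op {R : Type*} [Ring R] (e : R ≃+* Rᵐᵒᵖ) :
    IsRightNoetherian R ↔ IsLeftNoetherian R := by
  let l : R ≃ₗ[Rᵐᵒᵖ] Rᵐᵒᵖ :=
    { MulOpposite.opAddEquiv with map_smul' := fun _ _ => rfl }
  constructor
  · intro h
    have : IsNoetherian Rᵐᵒᵖ R := h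
    have : IsNoetherianRing Rᵐᵒᵖ := isNoetherian_of_linearEquiv l
    exact isNoetherianRing_of_ringEquiv Rᵐᵒᵖ e.symm
  · intro h
    have : IsNoetherianRing R := h
    have : IsNoetherianRing Rᵐᵒᵖ := isNoetherianRing_of_ringEquiv R e
    exact isNoetherian_of_linearEquiv l.symm

end Idealiser

end

theorem mainTheorem6 (I : Ideal Idealiser.Poly) (hprime : I.IsPrime) (hmax : ¬ I.IsMaximal)
    (hbot : I ≠ ⊥) (hline : ¬ Idealiser.IsRationalLine I) :
    (Idealiser.IsLeftNoetherian (Idealiser.idealiser (Idealiser.rightExt I)) ↔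
        Idealiser.FiniteOnCosets I) ∧
      (Idealiser.IsRightNoetherian (Idealiser.idealiser (Idealiser.rightExt I)) ↔
        Idealiser.FiniteOnCosets I) ∧
      ∃ f : Idealiser.Poly, Irreducible f ∧ I = Ideal.span {f} ∧
        ∃ θ : Idealiser.idealiser (Idealiser.rightExt I) ≃+*
            Idealiser.leftIdealiser (Idealiser.leftExt I),
          ∀ a : Idealiser.idealiser (Idealiser.rightExt I),
            Idealiser.incl f * (θ a : Idealiser.Skew) = (a : Idealiser.Skew) * Idealiser.incl f := by
  obtain ⟨f, hf, rfl⟩ := Idealiser.exists_irreducible_eq_span hprime hmax hbot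
  have hleft : Idealiser.IsLeftNoetherian (Idealiser.idealiser (Idealiser.rightExt
      (Ideal.span {f}))) ↔ Idealiser.FiniteOnCosets (Ideal.span {f}) :=
    ⟨Idealiser.finiteOnCosets_of_isLeftNoetherian hf hline,
      Idealiser.isLeftNoetherian_of_finiteOnCosets hf hline⟩
  obtain ⟨e⟩ := Idealiser.exists_idealiser_equiv_op hf.ne_zero
  exact ⟨hleft, (Idealiser.isRightNoetherian_iff_of_equiv_op e).trans hleft, f, hf, rfl,
    Idealiser.exists_idealiser_equiv hf.ne_zero⟩
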